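/- **Conventions.** A functor $T:\mathbf{Set}\to\mathbf{Set}$ is *semi-analytic* if it is finitary (preserves filtered colimits) and preserves pullbacks along monomorphisms. A natural transformation between endofunctors of $\mathbf{Set}$ is *semi-cartesian* if its naturality squares at injections are pullbacks. A monad $(T,\eta,\mu)$ on $\mathbf{Set}$ is *semi-analytic* if $T$ is semi-analytic and $\eta,\mu$ are semi-cartesian. For $t\in T(X)$, the *support* $\operatorname{supp}(t)\subseteq X$ is the least subset $S$ such that $t$ lies in the image of $T(S)\to T(X)$; it exists and is finite when $T$ is semi-analytic, and we regard $t$ also as an element of $T(\operatorname{supp}(t))$ (the map $T(\operatorname{supp}(t))\to T(X)$ is injective). **Regular polynomials.** Let $L$ be a sup-semilattice with a least element. The *regular polynomials* over $L$ form the following structure $CP_r(L)$. Its objects are the elements of $L$; a morphism $a\to b$ is a finite set $S\subseteq L$ with $a\in S$ and $\bigvee S=b$; the identity of $a$ is $\{a\}$; the composite of $S:a\to b$ and $S':b\to c$ is $(S'\setminus\{b\})\cup S$ (substitution of $S$ for $b$ in $S'$). A *functor* from $CP_r(L)$ to a category is an assignment on objects and morphisms that preserves domains, codomains, identities and composites.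 (Composition in $CP_r(L)$ need not be associative.) **Płonka sums.** Let $T$ be a semi-analytic monad and let $\mathbf F:CP_r(L)\to EM(T)$ be a functor to the Eilenberg–Moore category, with $\mathbf F(a)=(F(a),\xi_a)$. The *Płonka sum* $\bigsqcup_L\mathbf F$ is the set $\coprod_{a\in L}F(a)$ with the structure map $$T\Big(\coprod_{a\in L}F(a)\Big)\xrightarrow{\ \lambda\ }\coprod_{a\in L}T(F(a))\xrightarrow{\ \coprod_a\xi_a\ }\coprod_{a\in L}F(a),$$ where $\lambda$ is defined as follows. Given $t$, let $S\subseteq L$ be the finite set of the indices of the summands that meet $\operatorname{supp}(t)$ and put $b=\bigvee S$; then $\lambda(t)$ is the element of $T(F(b))$ (in the summand $b$) obtained by applying to $t\in T(\operatorname{supp}(t))$ the map $T(m)$, where $m:\operatorname{supp}(t)\to F(b)$ sends $x\in F(a)$ to $\mathbf F(S:a\to b)(x)$. We say that the Płonka sum of $\mathbf F$ *is a $T$-algebra* if this structure map satisfies the axioms of an Eilenberg–Moore algebra. **Theorem.** Let $R$ and $V$ be semi-analytic monads on $\mathbf{Set}$, let $\tau:R\to V$ be an arbitrary morphism of monads (a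 natural transformation compatible with the units and the multiplications), and let $EM(\tau):EM(V)\to EM(R)$, $(B,\beta)\mapsto(B,\beta\circ\tau_B)$, be the induced functor. The following are equivalent. 1. $\tau$ is semi-cartesian. 2. $EM(\tau)$ preserves all Płonka sums: for every sup-semilattice $L$ with a least element and every functor $\mathbf F:CP_r(L)\to EM(V)$, the two structure maps $R(\coprod_aF(a))\to\coprod_aF(a)$ coincide, namely the structure map of $\bigsqcup_L\mathbf F$ precomposed with $\tau$, and the structure map of $\bigsqcup_L(EM(\tau)\circ\mathbf F)$. 3. $EM(\tau)$ preserves the Płonka sums that are algebras: for every sup-semilattice $L$ with a least element and every functor $\mathbf F:CP_r(L)\to EM(V)$ whose Płonka sum is a $V$-algebra, the Płonka sum of $EM(\tau)\circ\mathbf F$ is an $R$-algebra, and the identity of $\coprod_aF(a)$ is an isomorphism $EM(\tau)\big(\bigsqcup_L\mathbf F\big)\cong\bigsqcup_L(EM(\tau)\circ\mathbf F)$. -/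

import Mathlib

open CategoryTheory CategoryTheory.Limits

universe u v w

attribute [-instance] CategoryTheory.catToReflQuiver

namespace Plonka

/-! ### Semi-analytic functors and monads on sets -/

/-- The functor sends every pullback square in which one of the two maps with common codomain is
injective to a pullback square. -/
def PreservesPullbacksAlongMonos (F : Type u ⥤ Type u) : Prop :=
  ∀ ⦃P X Y Z : Type u⦄ (p : P ⟶ X) (q : P ⟶ Y) (f : X ⟶ Z) (m : Y ⟶ Z), Mono m →
    IsPullback p q f m → IsPullback (F.map p) (F.map q) (F.map f) (F.map m)

/-- A semi-analytic functor: a finitary endofunctor of the category of sets that preserves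
pullbacks along monomorphisms. -/
structure IsSemiAnalytic (F : Type u ⥤ Type u) : Prop where
  finitary : PreservesFilteredColimits F
  pullbacks : PreservesPullbacksAlongMonos F

/-- A natural transformation is semi-cartesian if its naturality squares at injections are
pullbacks. -/
def IsSemiCartesian {F G : Type u ⥤ Type u} (α : F ⟶ G) : Prop :=
  ∀ ⦃X Y : Type u⦄ (f : X ⟶ Y), Mono f →
    IsPullback (F.map f) (α.app X) (α.app Y) (G.map f)

/-- A semi-analytic monad: a monoid in the monoidal category of semi-analytic functors and
semi-cartesian natural transformations. -/
structure IsSemiAnalyticMonad (T : Monad (Type u)) : Prop where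
  functor : IsSemiAnalytic T.toFunctor
  unit : IsSemiCartesian T.η
  mult : IsSemiCartesian T.μ

/-! ### Supports -/

/-- The support of `t : F X`: the intersection of all subsets `S` of `X` such that `t` comes from
`F S`. When `F` is semi-analytic and `t = [x, r]` for an injection `x` of a finite set `n` into `X`
and a coefficient `r` of arity `n`, this is the image of `x`. Thus `t ↦ supp t` is the canonical
morphism from a semi-analytic monad to the finite power-set monad. -/
def supp (F : Type u ⥤ Type u) {X : Type u} (t : F.obj X) : Set X :=
  {x | ∀ S : Set X, (∃ t' : F.obj S, F.map (TypeCat.ofHom (Subtype.val : S → X)) t' = t) → x ∈ S}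

theorem exists_finite {F : Type u ⥤ Type u} (hF : IsSemiAnalytic F) {X : Type u} (t : F.obj X) :
    ∃ S : Set X, S.Finite ∧
      ∃ t' : F.obj S, F.map (TypeCat.ofHom (Subtype.val : S → X)) t' = t := by
  have := hF.finitary
  have := HasCardinalLT.Set.isFiltered_of_aleph0_le X Cardinal.aleph0 le_rfl
  obtain ⟨⟨A, hA⟩, t', ht'⟩ := Types.jointly_surjective_of_isColimit
    (isColimitOfPreserves F (HasCardinalLT.Set.isColimitCocone X Cardinal.aleph0 le_rfl)) t
  exact ⟨A, (hasCardinalLT_aleph0_iff _).1 hA, t', ht'⟩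

theorem exists_inter {F : Type u ⥤ Type u} (hF : IsSemiAnalytic F) {X : Type u} (t : F.obj X)
    {S S' : Set X}
    (h : ∃ t' : F.obj S, F.map (TypeCat.ofHom (Subtype.val : S → X)) t' = t)
    (h' : ∃ t' : F.obj S', F.map (TypeCat.ofHom (Subtype.val : S' → X)) t' = t) :
    ∃ t' : F.obj (S ∩ S' : Set X),
      F.map (TypeCat.ofHom (Subtype.val : (S ∩ S' : Set X) → X)) t' = t := by
  obtain ⟨s, hs⟩ := h
  obtain ⟨s', hs'⟩ := h'
  have hm : Mono (TypeCat.ofHom (Subtype.val : S' → X)) :=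
    (mono_iff_injective _).2 Subtype.val_injective
  have hp : IsPullback
      (TypeCat.ofHom (fun x : (S ∩ S' : Set X) => (⟨x.1, x.2.1⟩ : S)))
      (TypeCat.ofHom (fun x : (S ∩ S' : Set X) => (⟨x.1, x.2.2⟩ : S')))
      (TypeCat.ofHom (Subtype.val : S → X)) (TypeCat.ofHom (Subtype.val : S' → X)) := by
    rw [Types.isPullback_iff]
    refine ⟨rfl, ?_, ?_⟩
    · rintro x y ⟨hxy, _⟩
      exact Subtype.ext (congrArg (Subtype.val : S → X) hxy)
    · rintro ⟨x, hx⟩ ⟨y, hy⟩ hxy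
      obtain rfl : x = y := hxy
      exact ⟨⟨x, hx, hy⟩, rfl, rfl⟩
  obtain ⟨t', ht', -⟩ := Types.exists_of_isPullback (hF.pullbacks _ _ _ _ hm hp) s s'
    (hs.trans hs'.symm)
  refine ⟨t', ?_⟩
  rw [← hs, ← ht', ← Functor.map_comp_apply]
  rfl

theorem exists_supp {F : Type u ⥤ Type u} (hF : IsSemiAnalytic F) {X : Type u} (t : F.obj X) :
    ∃ t' : F.obj (supp F t), F.map (TypeCat.ofHom (Subtype.val : supp F t → X)) t' = t := by
  classical
  have hex : ∃ n : ℕ, ∃ S : Set X, S.Finite ∧ S.ncard = n ∧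
      ∃ t' : F.obj S, F.map (TypeCat.ofHom (Subtype.val : S → X)) t' = t := by
    obtain ⟨S, hS, hSt⟩ := exists_finite hF t
    exact ⟨_, S, hS, rfl, hSt⟩
  obtain ⟨S, hS, hcard, hSt⟩ := Nat.find_spec hex
  have hsub : S ⊆ supp F t := by
    intro x hx S' hS't
    by_contra hxS'
    have hlt : (S ∩ S').ncard < S.ncard :=
      Set.ncard_lt_ncard ⟨Set.inter_subset_left, fun h => hxS' (h hx).2⟩ hS
    exact Nat.find_min hex (hcard ▸ hlt)
      ⟨S ∩ S', hS.subset Set.inter_subset_left, rfl, exists_inter hF t hSt hS't⟩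
  have heq : supp F t = S := Set.Subset.antisymm (fun x hx => hx S hSt) hsub
  rw [heq]
  exact hSt

theorem supp_finite {F : Type u ⥤ Type u} (hF : IsSemiAnalytic F) {X : Type u} (t : F.obj X) :
    (supp F t).Finite := by
  obtain ⟨S, hS, hSt⟩ := exists_finite hF t
  exact hS.subset fun x hx => hx S hSt

/-- The element `t : F X`, seen as an element of `F (supp t)`. -/
noncomputable def restrict {F : Type u ⥤ Type u} (hF : IsSemiAnalytic F) {X : Type u}
    (t : F.obj X) : F.obj (supp F t) :=
  (exists_supp hF t).choose

/-! ### Regular polynomials over a sup-semilattice -/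

/-- The objects of the structure of regular polynomials over a sup-semilattice (with a least
element, the supremum of the empty set) `L`: the elements of `L`. -/
structure RegPoly (L : Type u) : Type u where
  el : L

/-- A morphism `a ⟶ b` is a regular polynomial over `L` with a chosen variable: the finite set of
the (distinct) elements of `L` that interpret the variables, containing the value `a` of the chosen
variable, and with supremum `b`. (A sup-semilattice has exactly one regular operation of each finite
arity, so that the values of the variables determine the polynomial.) -/
@[ext]
structure RegPoly.Hom {L : Type u} [SemilatticeSup L] [OrderBot L] (a b : RegPoly L) : Type u where
  vars : Finset L
  mem : a.el ∈ vars
  sup_eq : vars.sup id = b.el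

open Classical in
/-- The identity of `a` is the polynomial consisting of the variable `a` alone. The composite of
`S : a ⟶ b` and `S' : b ⟶ c` is obtained by substituting `S` for `b` in `S'`. (Composition is not
associative in general, so that this is not an instance of `Category`.) -/
noncomputable instance (L : Type u) [SemilatticeSup L] [OrderBot L] :
    CategoryStruct.{u} (RegPoly L) where
  Hom a b := RegPoly.Hom a b
  id a := ⟨{a.el}, Finset.mem_singleton_self _, Finset.sup_singleton⟩
  comp {_ b _} S S' :=
    ⟨S'.vars.erase b.el ∪ S.vars, Finset.mem_union_right _ S.mem, by
      have h : (insert b.el (S'.vars.erase b.el)).sup id = S'.vars.sup id := by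
        rw [Finset.insert_erase S'.mem]
      rw [Finset.sup_insert, S'.sup_eq] at h
      rw [Finset.sup_union, S.sup_eq, sup_comm]
      exact h⟩

/-- A functor from the regular polynomials over `L` to a category `C`: an assignment on objects and
on morphisms that preserves domains, codomains, identities and composites. -/
structure Diagram (L : Type u) [SemilatticeSup L] [OrderBot L] (C : Type v) [Category.{w} C]
    extends Prefunctor (RegPoly L) C where
  map_id : ∀ a : RegPoly L, map (𝟙 a) = 𝟙 (obj a)
  map_comp : ∀ {a b c : RegPoly L} (S : a ⟶ b) (S' : b ⟶ c), map (S ≫ S') = map S ≫ map S'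

/-- The composite of a functor on the regular polynomials with a functor of categories. -/
def Diagram.comp {L : Type u} [SemilatticeSup L] [OrderBot L] {C : Type*} [Category C]
    {D : Type*} [Category D] (F : Diagram L C) (G : C ⥤ D) : Diagram L D where
  obj a := G.obj (F.obj a)
  map S := G.map (F.map S)
  map_id a := by rw [F.map_id, G.map_id]
  map_comp S S' := by rw [F.map_comp, G.map_comp]

/-! ### Płonka sums -/

section Sums

variable {L : Type u} [SemilatticeSup L] [OrderBot L]

/-- The coproduct of the values of a set-valued functor on the regular polynomials over `L`. -/
abbrev Diagram.coprod (G : Diagram L (Type u)) : Type u := Σ a : RegPoly L, G.obj a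

open Classical in
/-- The finite set of the indices `a` of the summands that are met by the support of `t`. -/
noncomputable def indices {T : Type u ⥤ Type u} (hT : IsSemiAnalytic T) (G : Diagram L (Type u))
    (t : T.obj G.coprod) : Finset L :=
  (supp_finite hT t).toFinset.image fun x => x.1.el

theorem fst_mem_indices {T : Type u ⥤ Type u} (hT : IsSemiAnalytic T) (G : Diagram L (Type u))
    (t : T.obj G.coprod) (x : supp T t) : x.1.1.el ∈ indices hT G t := by
  classical
  exact Finset.mem_image_of_mem (fun x : G.coprod => x.1.el) ((supp_finite hT t).mem_toFinset.2 x.2)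

/-- The supremum of the indices of `t`. -/
noncomputable def target {T : Type u ⥤ Type u} (hT : IsSemiAnalytic T) (G : Diagram L (Type u))
    (t : T.obj G.coprod) : RegPoly L :=
  ⟨(indices hT G t).sup id⟩

/-- The regular polynomial from the index of a point of the support of `t` to the target of `t`
that is given by all the indices of `t`. -/
noncomputable def transition {T : Type u ⥤ Type u} (hT : IsSemiAnalytic T)
    (G : Diagram L (Type u)) (t : T.obj G.coprod) (x : supp T t) : x.1.1 ⟶ target hT G t :=
  (⟨indices hT G t, fst_mem_indices hT G t x, rfl⟩ : RegPoly.Hom _ _)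

/-- The map `λ : T (∐ G a) ⟶ ∐ T (G a)`: it moves all the points of the support of `t` to the
summand at the target of `t`, along the transition maps of `G`. -/
noncomputable def plonkaLambda {T : Type u ⥤ Type u} (hT : IsSemiAnalytic T)
    (G : Diagram L (Type u)) (t : T.obj G.coprod) : Σ a : RegPoly L, T.obj (G.obj a) :=
  ⟨target hT G t,
    T.map (TypeCat.ofHom fun x : supp T t => G.map (transition hT G t x) x.1.2) (restrict hT t)⟩

variable {T : Monad (Type u)}

/-- The underlying set `∐ F a` of the Płonka sum of a diagram of `T`-algebras. -/
abbrev plonkaCarrier (F : Diagram L T.Algebra) : Type u := (F.comp T.forget).coprod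

/-- The structure map `T (∐ F a) ⟶ ∐ F a` of the Płonka sum of a diagram `F` of `T`-algebras: the
map `λ` followed by the coproduct of the structure maps of the algebras `F a`. -/
noncomputable def plonkaStructure (hT : IsSemiAnalytic T.toFunctor) (F : Diagram L T.Algebra) :
    T.obj (plonkaCarrier F) ⟶ plonkaCarrier F :=
  TypeCat.ofHom fun t =>
    let y := plonkaLambda hT (F.comp T.forget) t
    ⟨y.1, (F.obj y.1).a y.2⟩

/-- The axioms of an Eilenberg–Moore algebra for the structure map of the Płonka sum of `F`. -/
structure HasPlonkaSum (hT : IsSemiAnalytic T.toFunctor) (F : Diagram L T.Algebra) : Prop where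
  unit : T.η.app (plonkaCarrier F) ≫ plonkaStructure hT F = 𝟙 (plonkaCarrier F)
  assoc : T.μ.app (plonkaCarrier F) ≫ plonkaStructure hT F =
    T.map (plonkaStructure hT F) ≫ plonkaStructure hT F

/-- The Płonka sum of `F` as an Eilenberg–Moore algebra. -/
noncomputable def plonkaSum (hT : IsSemiAnalytic T.toFunctor) (F : Diagram L T.Algebra)
    (h : HasPlonkaSum hT F) : T.Algebra where
  A := plonkaCarrier F
  a := plonkaStructure hT F
  unit := h.unit
  assoc := h.assoc

end Sums

/-! ### Preservation of Płonka sums -/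

section Preservation

variable {R V : Monad (Type u)}

/-- The functor `EM(τ)` between the Eilenberg–Moore categories. -/
abbrev EM (τ : R ⟶ V) : V.Algebra ⥤ R.Algebra := Monad.algebraFunctorOfMonadHom τ

/-- `EM(τ)` preserves all Płonka sums: for every diagram `F` of `V`-algebras, indexed by the regular
polynomials over a sup-semilattice, the two `R`-structures on the coproduct of the underlying sets
coincide: the one obtained through `τ` from the `V`-structure of the Płonka sum of `F`, and the one
of the Płonka sum of the diagram `EM(τ) ∘ F` of `R`-algebras. -/
def PreservesPlonkaSums (hR : IsSemiAnalytic R.toFunctor) (hV : IsSemiAnalytic V.toFunctor)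
    (τ : R ⟶ V) : Prop :=
  ∀ (L : Type u) [SemilatticeSup L] [OrderBot L] (F : Diagram L V.Algebra),
    τ.app (plonkaCarrier F) ≫ plonkaStructure hV F = plonkaStructure hR (F.comp (EM τ))

/-- `EM(τ)` preserves the Płonka sums that are Eilenberg–Moore algebras: whenever the Płonka sum of
`F` is a `V`-algebra, the Płonka sum of `EM(τ) ∘ F` is an `R`-algebra, and the identity map of the
common underlying set is an isomorphism from the image under `EM(τ)` of the former to the latter. -/
def PreservesPlonkaAlgebras (hR : IsSemiAnalytic R.toFunctor) (hV : IsSemiAnalytic V.toFunctor)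
    (τ : R ⟶ V) : Prop :=
  ∀ (L : Type u) [SemilatticeSup L] [OrderBot L] (F : Diagram L V.Algebra)
    (h : HasPlonkaSum hV F),
    ∃ (h' : HasPlonkaSum hR (F.comp (EM τ)))
      (e : (EM τ).obj (plonkaSum hV F h) ≅ plonkaSum hR (F.comp (EM τ)) h'),
      e.hom.f = 𝟙 (plonkaCarrier F)

end Preservation

end Plonka

namespace Plonka

/-! ### Supports under maps, natural transformations and monad structure -/

section Support

variable {F G : Type u ⥤ Type u}

/-! Everything is controlled by supports. For an injection `f`, the image of `F.map f` consists of
the elements supported in the range of `f`; hence a transformation of semi-analytic functors is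
semi-cartesian exactly when it preserves supports.

A Płonka structure map sees an element only through its support, the indices of that support, and
the element restricted to it. If `τ` preserves supports, naturality at the map into the target
summand therefore identifies the two structures. Once the structure maps agree, the algebra axioms
transfer.

For the converse, test on one-element algebras. Their Płonka sum is `L` itself, with an element sent
to the join of its support; it is an algebra because the unit and multiplication are semi-cartesian
(`supp_unit`, `supp_mult_subset_iff`). With `L = Set X` and each `x` placed at `{x}`, this join is
the support itself, so preserving this single sum forces `τ` to preserve supports on `X`. -/

theorem map_injective (hF : IsSemiAnalytic F) {X Y : Type u} (f : X ⟶ Y) (hf : Mono f) :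
    Function.Injective (F.map f) := by
  have h := hF.pullbacks (𝟙 X) (𝟙 X) f f hf (IsKernelPair.id_of_mono f)
  intro a b hab
  obtain ⟨c, hc, hc'⟩ := Types.exists_of_isPullback h a b hab
  exact hc.symm.trans hc'

/-- An element comes from a subset if and only if the subset contains its support. -/
theorem exists_map_val_iff (hF : IsSemiAnalytic F) {X : Type u} (t : F.obj X) (S : Set X) :
    (∃ t' : F.obj S, F.map (TypeCat.ofHom (Subtype.val : S → X)) t' = t) ↔ supp F t ⊆ S := by
  refine ⟨fun h x hx => hx S h, fun h => ?_⟩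
  obtain ⟨t', ht'⟩ := exists_supp hF t
  refine ⟨F.map (TypeCat.ofHom (Set.inclusion h)) t', ?_⟩
  rw [← Functor.map_comp_apply]
  exact ht'

theorem exists_map_iff (hF : IsSemiAnalytic F) {X Y : Type u} (f : X ⟶ Y) (t : F.obj Y)
    (hf : Mono f) : (∃ t' : F.obj X, F.map f t' = t) ↔ supp F t ⊆ Set.range f := by
  rw [← exists_map_val_iff hF]
  have hinj : Function.Injective f := (mono_iff_injective f).1 hf
  constructor
  · rintro ⟨t', rfl⟩
    refine ⟨F.map (TypeCat.ofHom fun x => (⟨f x, x, rfl⟩ : Set.range f)) t', ?_⟩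
    rw [← Functor.map_comp_apply]
    rfl
  · rintro ⟨t', rfl⟩
    refine ⟨F.map (TypeCat.ofHom fun y : Set.range f => y.2.choose) t', ?_⟩
    rw [← Functor.map_comp_apply]
    exact congrArg (fun g => F.map g t')
      (ConcreteCategory.hom_ext _ _ fun y : Set.range f => y.2.choose_spec)

/-- The two sets have the same supersets: the preimage of `S` is the pullback of the injection of
`S` along `f`, and `F` preserves it, so `F.map f t` comes from `S` iff `t` comes from `f ⁻¹' S`.
Injectivity of `f` is not needed. -/
theorem supp_map (hF : IsSemiAnalytic F) {X Y : Type u} (f : X ⟶ Y) (t : F.obj X) :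
    supp F (F.map f t) = f '' supp F t := by
  refine eq_of_forall_ge_iff fun S => ?_
  change supp F (F.map f t) ⊆ S ↔ f '' supp F t ⊆ S
  rw [Set.image_subset_iff, ← exists_map_val_iff hF, ← exists_map_val_iff hF]
  constructor
  · rintro ⟨s, hs⟩
    have hm : Mono (TypeCat.ofHom (Subtype.val : S → Y)) :=
      (mono_iff_injective _).2 Subtype.val_injective
    have hp : IsPullback (TypeCat.ofHom (Subtype.val : (f ⁻¹' S : Set X) → X))
        (TypeCat.ofHom fun x : (f ⁻¹' S : Set X) => (⟨f x.1, x.2⟩ : S))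
        f (TypeCat.ofHom (Subtype.val : S → Y)) := by
      rw [Types.isPullback_iff]
      refine ⟨rfl, fun x y h => Subtype.ext h.1, ?_⟩
      rintro x ⟨y, hy⟩ (rfl : f x = y)
      exact ⟨⟨x, hy⟩, rfl, rfl⟩
    obtain ⟨t', ht', -⟩ := Types.exists_of_isPullback (hF.pullbacks _ _ _ _ hm hp) t s hs.symm
    exact ⟨t', ht'⟩
  · rintro ⟨t', rfl⟩
    refine ⟨F.map (TypeCat.ofHom fun x : (f ⁻¹' S : Set X) => (⟨f x.1, x.2⟩ : S)) t', ?_⟩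
    rw [← Functor.map_comp_apply, ← Functor.map_comp_apply]
    rfl

theorem IsSemiCartesian.exists_map_iff {α : F ⟶ G} (hα : IsSemiCartesian α) {X Y : Type u}
    (f : X ⟶ Y) (hf : Mono f) (t : F.obj Y) :
    (∃ s : G.obj X, G.map f s = α.app Y t) ↔ ∃ t' : F.obj X, F.map f t' = t := by
  constructor
  · rintro ⟨s, hs⟩
    obtain ⟨t', ht', -⟩ := Types.exists_of_isPullback (hα f hf) t s hs.symm
    exact ⟨t', ht'⟩
  · rintro ⟨t', rfl⟩
    exact ⟨α.app X t', (NatTrans.naturality_apply α f t').symm⟩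

theorem IsSemiCartesian.supp_app (hF : IsSemiAnalytic F) (hG : IsSemiAnalytic G) {α : F ⟶ G}
    (hα : IsSemiCartesian α) {X : Type u} (t : F.obj X) :
    supp G (α.app X t) = supp F t := by
  refine eq_of_forall_ge_iff fun S => ?_
  change _ ⊆ S ↔ _ ⊆ S
  rw [← exists_map_val_iff hF, ← exists_map_val_iff hG]
  exact hα.exists_map_iff _ ((mono_iff_injective _).2 Subtype.val_injective) t

/-- Equal supports let `t` lift along `F.map f`; injectivity of `F.map f` and `G.map f` gives
uniqueness and the other leg of the pullback. -/
theorem isSemiCartesian_of_supp_app (hF : IsSemiAnalytic F) (hG : IsSemiAnalytic G) {α : F ⟶ G}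
    (h : ∀ (X : Type u) (t : F.obj X), supp G (α.app X t) = supp F t) : IsSemiCartesian α := by
  intro X Y f hf
  rw [Types.isPullback_iff]
  refine ⟨α.naturality f, fun a b hab => map_injective hF f hf hab.1, fun t s hts => ?_⟩
  obtain ⟨t', ht'⟩ : ∃ t' : F.obj X, F.map f t' = t := by
    rw [exists_map_iff hF f t hf, ← h, ← exists_map_iff hG f _ hf]
    exact ⟨s, hts.symm⟩
  refine ⟨t', ht', map_injective hG f hf ?_⟩
  rw [← hts, ← ht']
  exact (NatTrans.naturality_apply α f t').symm

variable {T : Monad (Type u)}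

theorem supp_unit (hT : IsSemiAnalyticMonad T) {X : Type u} (x : X) :
    supp T.toFunctor (T.η.app X x) = {x} := by
  refine eq_of_forall_ge_iff fun S => ?_
  change _ ⊆ S ↔ {x} ⊆ S
  rw [← exists_map_val_iff hT.functor, Set.singleton_subset_iff]
  refine (hT.unit.exists_map_iff _ ((mono_iff_injective _).2 Subtype.val_injective) x).trans ?_
  constructor
  · rintro ⟨y, rfl⟩
    exact y.2
  · exact fun h => ⟨⟨x, h⟩, rfl⟩

/-- Semi-cartesianness of `μ` reduces the claim to `t` coming from `T (T S)`. The injection `T S → T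
X` has as range the elements supported in `S`, so its range must contain the support of `t`. -/
theorem supp_mult_subset_iff (hT : IsSemiAnalyticMonad T) {X : Type u} (t : T.obj (T.obj X))
    (S : Set X) : supp T.toFunctor (T.μ.app X t) ⊆ S ↔
      ∀ s ∈ supp T.toFunctor t, supp T.toFunctor s ⊆ S := by
  have hm : Mono (TypeCat.ofHom (Subtype.val : S → X)) :=
    (mono_iff_injective _).2 Subtype.val_injective
  rw [← exists_map_val_iff hT.functor]
  refine (hT.mult.exists_map_iff _ hm t).trans ?_
  refine (exists_map_iff hT.functor (T.map (TypeCat.ofHom (Subtype.val : S → X))) t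
    ((mono_iff_injective _).2 (map_injective hT.functor _ hm))).trans ?_
  exact forall₂_congr fun s _ => exists_map_val_iff hT.functor s S

end Support

/-! ### Computing the map `λ` -/

section Sums

variable {L : Type u} [SemilatticeSup L] [OrderBot L]

theorem target_le_iff {T : Type u ⥤ Type u} (hT : IsSemiAnalytic T) (G : Diagram L (Type u))
    (t : T.obj G.coprod) (c : L) :
    (target hT G t).el ≤ c ↔ ∀ x ∈ supp T t, x.1.el ≤ c := by
  simp [target, indices, Finset.sup_le_iff]

/-- The map `λ` can be computed from any presentation of the support of `t`, of its indices, and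
of `t` as an element over its support. -/
theorem plonkaLambda_eq {T : Type u ⥤ Type u} (hT : IsSemiAnalytic T) (G : Diagram L (Type u))
    (t : T.obj G.coprod) {S : Set G.coprod} (hS : supp T t = S) (s : T.obj S)
    (hs : T.map (TypeCat.ofHom (Subtype.val : S → G.coprod)) s = t) {I : Finset L}
    (hI : indices hT G t = I) (hmem : ∀ x : S, x.1.1.el ∈ I) :
    plonkaLambda hT G t = ⟨⟨I.sup id⟩, T.map (TypeCat.ofHom fun x : S =>
      G.map (⟨I, hmem x, rfl⟩ : RegPoly.Hom x.1.1 ⟨I.sup id⟩) x.1.2) s⟩ := by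
  subst hS hI
  -- `restrict` is a choice, but injectivity of `T.map` at the inclusion makes it the only possible
  -- one.
  have h : s = restrict hT t :=
    map_injective hT _ ((mono_iff_injective _).2 Subtype.val_injective)
      (hs.trans (exists_supp hT t).choose_spec.symm)
  rw [h]
  rfl

end Sums

/-! ### Preservation of Płonka sums and the test diagram -/

section Preservation

variable {R V : Monad (Type u)}

theorem preservesPlonkaSums_of_isSemiCartesian (hR : IsSemiAnalytic R.toFunctor)
    (hV : IsSemiAnalytic V.toFunctor) {τ : R ⟶ V} (hτ : IsSemiCartesian τ.toNatTrans) :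
    PreservesPlonkaSums hR hV τ := by
  intro L _ _ F
  refine ConcreteCategory.hom_ext _ _ fun t => ?_
  have hsupp := hτ.supp_app hR hV t
  have hI : indices hV (F.comp V.forget) (τ.app _ t) =
      indices hR ((F.comp (EM τ)).comp R.forget) t := by
    unfold indices
    congr 1
    exact Set.Finite.toFinset_inj.2 hsupp
  have hs : V.map (TypeCat.ofHom (Subtype.val : supp R.toFunctor t → plonkaCarrier F))
      (τ.app _ (restrict hR t)) = τ.app _ t := by
    refine (NatTrans.naturality_apply τ.toNatTrans _ _).symm.trans ?_
    exact congrArg (τ.app _) (exists_supp hR t).choose_spec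
  have h := plonkaLambda_eq hV (F.comp V.forget) (τ.app _ t) hsupp (τ.app _ (restrict hR t)) hs hI
    (fst_mem_indices hR ((F.comp (EM τ)).comp R.forget) t)
  change (⟨(plonkaLambda hV (F.comp V.forget) (τ.app _ t)).1,
    (F.obj _).a (plonkaLambda hV (F.comp V.forget) (τ.app _ t)).2⟩ : plonkaCarrier F) = _
  rw [h]
  -- Both values now lie in the same summand; what remains is naturality of `τ` at the transition
  -- map.
  refine Sigma.ext rfl (heq_of_eq ?_)
  exact congrArg (F.obj _).a (NatTrans.naturality_apply τ.toNatTrans _ _).symm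

theorem PreservesPlonkaSums.preservesPlonkaAlgebras {hR : IsSemiAnalytic R.toFunctor}
    {hV : IsSemiAnalytic V.toFunctor} {τ : R ⟶ V} (h : PreservesPlonkaSums hR hV τ) :
    PreservesPlonkaAlgebras hR hV τ := by
  intro L _ _ F hF
  have heq := h L F
  have h' : HasPlonkaSum hR (F.comp (EM τ)) := by
    constructor
    · exact heq ▸ ((EM τ).obj (plonkaSum hV F hF)).unit
    · exact heq ▸ ((EM τ).obj (plonkaSum hV F hF)).assoc
  refine ⟨h', Monad.Algebra.isoMk (Iso.refl (plonkaCarrier F)) ?_, rfl⟩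
  exact (congrArg (· ≫ plonkaStructure hR (F.comp (EM τ)))
    (CategoryTheory.Functor.map_id R.toFunctor (plonkaCarrier F))).trans heq.symm

/-- The algebra with one element. -/
def punitAlgebra (T : Monad (Type u)) : T.Algebra where
  A := PUnit
  a := TypeCat.ofHom fun _ => PUnit.unit
  unit := rfl
  assoc := rfl

/-- The constant diagram at the algebra with one element. -/
def punitDiagram (L : Type u) [SemilatticeSup L] [OrderBot L] (T : Monad (Type u)) :
    Diagram L T.Algebra where
  obj _ := punitAlgebra T
  map _ := 𝟙 _
  map_id _ := rfl
  map_comp _ _ := (Category.comp_id _).symm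

theorem punitDiagram_ext {L : Type u} [SemilatticeSup L] [OrderBot L] {T : Monad (Type u)}
    {x y : plonkaCarrier (punitDiagram L T)} (h : x.1.el = y.1.el) : x = y := by
  obtain ⟨⟨a⟩, ⟨⟩⟩ := x
  obtain ⟨⟨b⟩, ⟨⟩⟩ := y
  obtain rfl : a = b := h
  rfl

theorem plonkaStructure_punitDiagram_le_iff {L : Type u} [SemilatticeSup L] [OrderBot L]
    {T : Monad (Type u)} (hT : IsSemiAnalytic T.toFunctor)
    (t : T.obj (plonkaCarrier (punitDiagram L T))) (c : L) :
    (plonkaStructure hT (punitDiagram L T) t).1.el ≤ c ↔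
      ∀ x ∈ supp T.toFunctor t, x.1.el ≤ c :=
  target_le_iff hT _ t c

/-- The Płonka sum of one-element algebras is an algebra: it is `L` itself, with the structure
induced by the support, a morphism to the finite power-set monad. -/
theorem hasPlonkaSum_punitDiagram (L : Type u) [SemilatticeSup L] [OrderBot L]
    {T : Monad (Type u)} (hT : IsSemiAnalyticMonad T) :
    HasPlonkaSum hT.functor (punitDiagram L T) := by
  constructor
  · refine ConcreteCategory.hom_ext _ _ fun x =>
      punitDiagram_ext (eq_of_forall_ge_iff (α := L) fun c => ?_)
    refine (plonkaStructure_punitDiagram_le_iff hT.functor (T.η.app _ x) c).trans ?_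
    rw [supp_unit hT (X := plonkaCarrier (punitDiagram L T)) x]
    exact forall_eq
  · refine ConcreteCategory.hom_ext _ _ fun t =>
      punitDiagram_ext (eq_of_forall_ge_iff (α := L) fun c => ?_)
    refine (plonkaStructure_punitDiagram_le_iff hT.functor (T.μ.app _ t) c).trans ?_
    refine Iff.trans ?_ (plonkaStructure_punitDiagram_le_iff hT.functor
      (T.map (plonkaStructure hT.functor (punitDiagram L T)) t) c).symm
    refine (supp_mult_subset_iff hT t {x | x.1.el ≤ c}).trans ?_
    rw [supp_map hT.functor, Set.forall_mem_image]
    exact forall₂_congr fun s _ => (plonkaStructure_punitDiagram_le_iff hT.functor s c).symm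

/-- An algebra morphism whose underlying map is the identity forces the two structure maps to be
equal. -/
theorem PreservesPlonkaAlgebras.app_comp_plonkaStructure {hR : IsSemiAnalytic R.toFunctor}
    {hV : IsSemiAnalytic V.toFunctor} {τ : R ⟶ V} (h : PreservesPlonkaAlgebras hR hV τ)
    {L : Type u} [SemilatticeSup L] [OrderBot L] (F : Diagram L V.Algebra)
    (hF : HasPlonkaSum hV F) :
    τ.app (plonkaCarrier F) ≫ plonkaStructure hV F = plonkaStructure hR (F.comp (EM τ)) := by
  obtain ⟨h', e, he⟩ := h L F hF
  have hmap : R.map e.hom.f = 𝟙 (R.obj (plonkaCarrier F)) :=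
    (congrArg (fun f : plonkaCarrier F ⟶ plonkaCarrier F => R.map f) he).trans
      (CategoryTheory.Functor.map_id R.toFunctor (plonkaCarrier F))
  refine ConcreteCategory.hom_ext _ _ fun t => ?_
  have H := ConcreteCategory.congr_hom e.hom.h t
  have h₁ : (R.map e.hom.f ≫ (plonkaSum hR (F.comp (EM τ)) h').a) t =
      plonkaStructure hR (F.comp (EM τ)) t :=
    congrArg (plonkaStructure hR (F.comp (EM τ))) (ConcreteCategory.congr_hom hmap t)
  have h₂ : (((EM τ).obj (plonkaSum hV F hF)).a ≫ e.hom.f) t =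
      (τ.app (plonkaCarrier F) ≫ plonkaStructure hV F) t :=
    ConcreteCategory.congr_hom he _
  exact h₂.symm.trans (H.symm.trans h₁)

theorem PreservesPlonkaAlgebras.supp_app (hR : IsSemiAnalyticMonad R)
    (hV : IsSemiAnalyticMonad V) {τ : R ⟶ V}
    (h : PreservesPlonkaAlgebras hR.functor hV.functor τ) (X : Type u) (t : R.obj X) :
    supp V.toFunctor (τ.app X t) = supp R.toFunctor t := by
  have heq := h.app_comp_plonkaStructure (punitDiagram (Set X) V)
    (hasPlonkaSum_punitDiagram (Set X) hV)
  -- In `Set X` a subset is the join of its singletons, so the index of the structure map's value at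
  -- the image of `t` recovers the support of `t`.
  let j : X ⟶ plonkaCarrier (punitDiagram (Set X) V) :=
    TypeCat.ofHom fun x => ⟨⟨{x}⟩, PUnit.unit⟩
  have hel : (plonkaStructure hV.functor (punitDiagram (Set X) V) (V.map j (τ.app X t))).1.el =
      (plonkaStructure hR.functor ((punitDiagram (Set X) V).comp (EM τ)) (R.map j t)).1.el := by
    rw [← heq]
    have hnat : V.map j (τ.app X t) = τ.app _ (R.map j t) :=
      (NatTrans.naturality_apply τ.toNatTrans j t).symm
    rw [hnat]
    rfl
  refine eq_of_forall_ge_iff (α := Set X) fun c => ?_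
  have hV' := plonkaStructure_punitDiagram_le_iff hV.functor (V.map j (τ.app X t)) c
  have hR' := target_le_iff hR.functor
    (((punitDiagram (Set X) V).comp (EM τ)).comp R.forget) (R.map j t) c
  rw [supp_map hV.functor, Set.forall_mem_image] at hV'
  have hs := supp_map hR.functor j t
  have hR'' : (∀ x ∈ supp R.toFunctor (R.map j t), x.1.el ≤ c) ↔
      ∀ x ∈ supp R.toFunctor t, ({x} : Set X) ≤ c := by
    rw [hs, Set.forall_mem_image]
    rfl
  have hle : ∀ A : Set X, (∀ x ∈ A, ({x} : Set X) ≤ c) ↔ A ≤ c := fun A =>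
    forall₂_congr fun x _ => Set.singleton_subset_iff
  rw [← hle, ← hle]
  exact (hV'.symm.trans (hel ▸ Iff.rfl)).trans (hR'.trans hR'')

end Preservation

end Plonka

theorem mainTheorem1 (R V : Monad (Type u))
    (hR : Plonka.IsSemiAnalyticMonad R) (hV : Plonka.IsSemiAnalyticMonad V) (τ : R ⟶ V) :
    List.TFAE [
      Plonka.IsSemiCartesian τ.toNatTrans,
      Plonka.PreservesPlonkaSums hR.functor hV.functor τ,
      Plonka.PreservesPlonkaAlgebras hR.functor hV.functor τ] := by
  tfae_have 1 → 2 := Plonka.preservesPlonkaSums_of_isSemiCartesian hR.functor hV.functor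
  tfae_have 2 → 3 := Plonka.PreservesPlonkaSums.preservesPlonkaAlgebras
  tfae_have 3 → 1 := fun h => Plonka.isSemiCartesian_of_supp_app hR.functor hV.functor
    (Plonka.PreservesPlonkaAlgebras.supp_app hR hV h)
  tfae_finish
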